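/- Let $H(\mathbb C)$ be the algebra of entire functions with the compact-open topology, and let $D$ be the operator of complex differentiation on $H(\mathbb C)$. Let $k,n\ge 1$ be integers, let $a_0,a_1\in\mathbb C$ with $|a_0|\le 1$ and $a_1\neq 0$, and let $P(z)=(a_0+a_1z^k)^n$. Then the operator $P(D)=(a_0I+a_1D^k)^n$ supports a hypercyclic algebra on $H(\mathbb C)$: there is a nonzero (not necessarily unital) subalgebra $A$ of $H(\mathbb C)$ such that for every $f\in A\setminus\{0\}$ the orbit $\{f,\,P(D)f,\,P(D)^2f,\dots\}$ is dense in $H(\mathbb C)$. -/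

import Mathlib

open Polynomial Filter Topology

noncomputable section

/-- The entire functions, as a subalgebra of the algebra `C(ℂ, ℂ)` of continuous functions. -/
def entireSubalgebra : Subalgebra ℂ C(ℂ, ℂ) where
  carrier := {f | Differentiable ℂ f}
  mul_mem' := fun hf hg => Differentiable.mul hf hg
  add_mem' := fun hf hg => Differentiable.add hf hg
  algebraMap_mem' := fun c => differentiable_const c

/-- The space `H(ℂ)` of entire functions. It is an algebra with the pointwise operations, and its
topology is the one induced by the compact-open topology of `C(ℂ, ℂ)`. -/
def EntireFunction : Type := entireSubalgebra

namespace EntireFunction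

instance : CommRing EntireFunction := inferInstanceAs (CommRing entireSubalgebra)

instance : Algebra ℂ EntireFunction := inferInstanceAs (Algebra ℂ entireSubalgebra)

/-- The inclusion of `H(ℂ)` in `C(ℂ, ℂ)`. -/
def toContinuousMap : EntireFunction →ₐ[ℂ] C(ℂ, ℂ) := entireSubalgebra.val

instance : TopologicalSpace EntireFunction :=
  TopologicalSpace.induced toContinuousMap ContinuousMap.compactOpen

theorem isInducing_toContinuousMap : IsInducing toContinuousMap := ⟨rfl⟩

theorem toContinuousMap_injective : Function.Injective toContinuousMap := Subtype.val_injective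

instance : IsTopologicalRing EntireFunction where
  continuous_add := isInducing_toContinuousMap.continuous_iff.2 <| by
    have h := isInducing_toContinuousMap.continuous
    simp only [Function.comp_def, map_add]
    exact (h.comp continuous_fst).add (h.comp continuous_snd)
  continuous_mul := isInducing_toContinuousMap.continuous_iff.2 <| by
    have h := isInducing_toContinuousMap.continuous
    simp only [Function.comp_def, map_mul]
    exact (h.comp continuous_fst).mul (h.comp continuous_snd)
  continuous_neg := isInducing_toContinuousMap.continuous_iff.2 <| by
    have h := isInducing_toContinuousMap.continuous
    simp only [Function.comp_def, map_neg]
    exact h.neg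

instance : ContinuousSMul ℂ EntireFunction where
  continuous_smul := isInducing_toContinuousMap.continuous_iff.2 <| by
    have h := isInducing_toContinuousMap.continuous
    simp only [Function.comp_def, map_smul]
    exact (continuous_fst (X := ℂ) (Y := EntireFunction)).smul (h.comp continuous_snd)

theorem differentiable (f : EntireFunction) : Differentiable ℂ f.toContinuousMap := f.2

theorem differentiable_deriv (f : EntireFunction) : Differentiable ℂ (deriv f.toContinuousMap) :=
  fun _ => (f.differentiable.differentiableOn.deriv isOpen_univ).differentiableAt univ_mem

/-- The complex derivative of an entire function, as an entire function. -/
def derivative (f : EntireFunction) : EntireFunction :=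
  ⟨⟨deriv f.toContinuousMap, f.differentiable_deriv.continuous⟩, f.differentiable_deriv⟩

theorem continuous_derivative : Continuous derivative := by
  refine isInducing_toContinuousMap.continuous_iff.2 (continuous_iff_continuousAt.2 fun f => ?_)
  have h : Tendsto toContinuousMap (𝓝 f) (𝓝 f.toContinuousMap) :=
    isInducing_toContinuousMap.continuous.continuousAt
  rw [ContinuousMap.tendsto_iff_tendstoLocallyUniformly, ← tendstoLocallyUniformlyOn_univ] at h
  refine ContinuousMap.tendsto_iff_tendstoLocallyUniformly.2 ?_
  rw [← tendstoLocallyUniformlyOn_univ]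
  exact h.deriv (Eventually.of_forall fun g => g.differentiable.differentiableOn) isOpen_univ

/-- The operator `D` of complex differentiation, a continuous linear operator on `H(ℂ)`. -/
def diffOp : EntireFunction →L[ℂ] EntireFunction where
  toFun := derivative
  map_add' := fun f g => toContinuousMap_injective <| ContinuousMap.ext fun z =>
    deriv_add (f.differentiable z) (g.differentiable z)
  map_smul' := fun c f => toContinuousMap_injective <| ContinuousMap.ext fun z =>
    deriv_const_smul c (f.differentiable z)
  cont := continuous_derivative

theorem diffOp_apply (f : EntireFunction) (z : ℂ) :
    (diffOp f).toContinuousMap z = deriv f.toContinuousMap z := rfl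

end EntireFunction

/-- `x` is a hypercyclic vector for `T`: its orbit `{x, T x, T² x, …}` is dense. -/
def IsHypercyclicVector {X : Type*} [TopologicalSpace X] [AddCommGroup X] [Module ℂ X]
    (T : X →L[ℂ] X) (x : X) : Prop :=
  Dense (Set.range fun j : ℕ => (T ^ j) x)

/-- `T` supports a hypercyclic algebra: there is a nonzero (not necessarily unital) subalgebra of
`X` all of whose nonzero elements are hypercyclic vectors for `T`. -/
def SupportsHypercyclicAlgebra {X : Type*} [TopologicalSpace X] [CommRing X] [Algebra ℂ X]
    (T : X →L[ℂ] X) : Prop :=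
  ∃ A : NonUnitalSubalgebra ℂ X, A ≠ ⊥ ∧ ∀ f ∈ A, f ≠ 0 → IsHypercyclicVector T f

end

/-!
The exponentials `z ↦ exp (c * z)` are eigenvectors of `P(D)` with eigenvalues `P c`, and the
product of two of them is again one. By a Baire category argument
(`supportsHypercyclicAlgebra_of_forall_exists`) it suffices to find, for each `m ≥ 1` and all
targets `A` and `B` in dense sets, functions `f_N → A` such that `P(D) ^ N` sends `f_N ^ m` close to
`B` and the lower powers of `f_N` close to `0`.

After a rotation and a scaling `c = z₀ * w` of the exponents, `|P c| = |(1 + b) * w ^ k - b| ^ n`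
with `b = |a₀| ≤ 1`, so that `w = 1` is a farthest point from the origin on the set `|P| ≤ 1`. Take
`A = ∑ a_p exp (α_p z)` with small positive `α_p`, and `B = ∑ b_q exp (γ_q z)` with `γ_q` on a short
segment through a point `s > 1` orthogonal to the real axis. Both families of exponentials span a
dense subspace (`EntireFunction.dense_span_expMul`). With `r_q ^ m = 1 / P(γ_q)` put
`f_N = A + ∑ b_q ^ (1/m) * r_q ^ N * exp (γ_q z / m)`. The image under `P(D) ^ N` of a power of
`f_N` is a sum of exponentials whose coefficients are geometric in `N`, and all the ratios that do
not come from `m` copies of one `γ_q` have modulus less than `1`: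

* if fewer than `m` of the `γ_q / m` occur, the exponent lies in a thin sector around `(0, ρ]` with
  `ρ < 1`, where `|P| < 1` (`exists_sector_norm_lt_one`);
* if `m` of them occur, not all equal, this is the strict Jensen inequality for `log |P|`, which is
  strictly convex along the segment (`exists_strictConvexOn_log_norm`): it is harmonic, and strictly
  concave in the radial direction.
-/

/-! ### The space of entire functions -/

noncomputable section

namespace EntireFunction

theorem isClosed_range_toContinuousMap : IsClosed (Set.range toContinuousMap) := by
  have hr : Set.range toContinuousMap = {f : C(ℂ, ℂ) | Differentiable ℂ f} :=
    Set.ext fun f => ⟨fun ⟨g, hg⟩ => hg ▸ g.differentiable, fun hf => ⟨⟨f, hf⟩, rfl⟩⟩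
  rw [hr, ← isSeqClosed_iff_isClosed]
  intro u f hu hf
  rw [ContinuousMap.tendsto_iff_tendstoLocallyUniformly, ← tendstoLocallyUniformlyOn_univ] at hf
  exact differentiableOn_univ.1
    (hf.differentiableOn (Eventually.of_forall fun i => (hu i).differentiableOn) isOpen_univ)

theorem isClosedEmbedding_toContinuousMap : IsClosedEmbedding toContinuousMap :=
  ⟨⟨isInducing_toContinuousMap, toContinuousMap_injective⟩, isClosed_range_toContinuousMap⟩

instance : T2Space EntireFunction := isClosedEmbedding_toContinuousMap.isEmbedding.t2Space

instance : SecondCountableTopology EntireFunction :=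
  isInducing_toContinuousMap.secondCountableTopology

instance : BaireSpace EntireFunction := by
  let : UniformSpace EntireFunction := UniformSpace.comap toContinuousMap inferInstance
  have hu : IsUniformInducing toContinuousMap := ⟨rfl⟩
  have : (uniformity EntireFunction).IsCountablyGenerated :=
    Filter.comap.isCountablyGenerated _ _
  have : CompleteSpace EntireFunction :=
    (completeSpace_iff_isComplete_range hu).2 isClosed_range_toContinuousMap.isComplete
  infer_instance

instance : Nontrivial EntireFunction := inferInstanceAs (Nontrivial entireSubalgebra)

theorem ext {f g : EntireFunction} (h : ∀ z, f.toContinuousMap z = g.toContinuousMap z) : f = g :=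
  toContinuousMap_injective (ContinuousMap.ext h)

/-- The entire function `z ↦ exp (c * z)`. -/
def expMul (c : ℂ) : EntireFunction :=
  ⟨⟨fun z => Complex.exp (c * z), by fun_prop⟩,
    show Differentiable ℂ fun z => Complex.exp (c * z) by fun_prop⟩

theorem expMul_apply (c z : ℂ) : (expMul c).toContinuousMap z = Complex.exp (c * z) := rfl

/-- The entire function `z ↦ z`. -/
def coord : EntireFunction := ⟨ContinuousMap.id ℂ, differentiable_id⟩

theorem coord_apply (z : ℂ) : coord.toContinuousMap z = z := rfl

theorem expMul_add (c d : ℂ) : expMul (c + d) = expMul c * expMul d := ext fun z => by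
  rw [map_mul, ContinuousMap.mul_apply]
  simp only [expMul_apply, add_mul, Complex.exp_add]

theorem expMul_zero : expMul 0 = 1 := ext fun z => by
  rw [map_one, ContinuousMap.one_apply, expMul_apply, zero_mul, Complex.exp_zero]

theorem diffOp_expMul (c : ℂ) : diffOp (expMul c) = c • expMul c := ext fun z => by
  rw [diffOp_apply, map_smul, ContinuousMap.smul_apply, expMul_apply, smul_eq_mul]
  have h : HasDerivAt (fun z => Complex.exp (c * z)) (Complex.exp (c * z) * (c * 1)) z :=
    ((hasDerivAt_id z).const_mul c).cexp
  exact h.deriv.trans (by ring)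

/-- The partial sums of the Taylor series at the origin converge in `H(ℂ)`, so a closed subspace
containing `z ↦ z ^ j * g z` for every `j` contains `f * g` for every entire `f`. -/
theorem mul_mem_of_forall_coord_pow_mul_mem {M : Submodule ℂ EntireFunction}
    (hM : IsClosed (M : Set EntireFunction)) {g : EntireFunction}
    (hg : ∀ j : ℕ, coord ^ j * g ∈ M) (f : EntireFunction) : f * g ∈ M := by
  have hf := (f.differentiable.hasFPowerSeriesOnBall 0 (R := 1) one_pos).tendstoLocallyUniformlyOn
  set p := cauchyPowerSeries f.toContinuousMap 0 (1 : NNReal)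
  have hT : Tendsto (fun N : ℕ => ∑ i ∈ Finset.range N, p.coeff i • coord ^ i) atTop (𝓝 f) := by
    refine isInducing_toContinuousMap.tendsto_nhds_iff.2
      (ContinuousMap.tendsto_iff_tendstoLocallyUniformly.2 ?_)
    rw [← tendstoLocallyUniformlyOn_univ]
    rw [Metric.eball_top] at hf
    refine (hf.congr fun N z _ => ?_).congr_right fun z _ => ?_
    · simp only [FormalMultilinearSeries.partialSum, FormalMultilinearSeries.apply_eq_pow_smul_coeff,
        Function.comp_apply, map_sum, map_smul, map_pow, ContinuousMap.sum_apply,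
        ContinuousMap.smul_apply, ContinuousMap.pow_apply, coord_apply, smul_eq_mul, mul_comm]
    · simp
  refine hM.mem_of_tendsto (hT.mul_const g) (Eventually.of_forall fun N => ?_)
  simp only [Finset.sum_mul, smul_mul_assoc, SetLike.mem_coe]
  exact M.sum_mem fun i _ => M.smul_mem _ (hg i)

/-- The difference quotients of `c ↦ expMul c` at `0` converge in `H(ℂ)`. -/
theorem tendsto_slope_expMul :
    Tendsto (fun h : ℂ => h⁻¹ • (expMul h - 1)) (𝓝[≠] 0) (𝓝 coord) := by
  have hφ : Continuous (dslope Complex.exp 0) := by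
    rw [← continuousOn_univ, continuousOn_dslope univ_mem]
    exact ⟨Complex.continuous_exp.continuousOn, Complex.differentiable_exp 0⟩
  -- `(exp (h * z) - 1) / h` extends to a jointly continuous function of `h` and `z`; currying it
  -- gives continuity in `h` for the compact-open topology.
  let F : C(ℂ × ℂ, ℂ) := ⟨fun p => p.2 * dslope Complex.exp 0 (p.1 * p.2), by fun_prop⟩
  have hF : Tendsto F.curry (𝓝[≠] 0) (𝓝 coord.toContinuousMap) := by
    refine Tendsto.mono_left (Continuous.tendsto' F.curry.continuous _ _ ?_) nhdsWithin_le_nhds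
    ext z
    simp [F, coord_apply]
  refine isInducing_toContinuousMap.tendsto_nhds_iff.2 (hF.congr' ?_)
  filter_upwards [self_mem_nhdsWithin] with h hh
  ext z
  have e := sub_smul_dslope Complex.exp 0 (h * z)
  rw [sub_zero, Complex.exp_zero, smul_eq_mul] at e
  simp only [Function.comp_apply, map_smul, map_sub, map_one, ContinuousMap.smul_apply,
    ContinuousMap.sub_apply, ContinuousMap.one_apply, expMul_apply, smul_eq_mul, ← e,
    ContinuousMap.curry_apply, F, ContinuousMap.coe_mk]
  rw [mul_assoc, inv_mul_cancel_left₀ hh]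

/-- Exponentials with exponents on a segment span a dense subspace: repeated differentiation in the
exponent puts every `z ^ j * exp (c * z)` into the closed span. -/
theorem dense_span_expMul {c η : ℂ} (hη : η ≠ 0) {a b : ℝ} (hab : a < b) :
    Dense (Submodule.span ℂ (Set.range fun t : Set.Ioo a b => expMul (c + (t : ℝ) * η)) :
      Set EntireFunction) := by
  set S := Submodule.span ℂ (Set.range fun t : Set.Ioo a b => expMul (c + (t : ℝ) * η))
  set M := S.topologicalClosure
  have hM : IsClosed (M : Set EntireFunction) := S.isClosed_topologicalClosure
  have key : ∀ (j : ℕ) (t : ℝ), t ∈ Set.Ioo a b → coord ^ j * expMul (c + t * η) ∈ M := by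
    intro j
    induction j with
    | zero =>
      intro t ht
      rw [pow_zero, one_mul]
      exact S.le_topologicalClosure (Submodule.subset_span ⟨⟨t, ht⟩, rfl⟩)
    | succ j ih =>
      intro t ht
      have h1 : Tendsto (fun s : ℝ => (s : ℂ) * η) (𝓝[≠] 0) (𝓝[≠] 0) := by
        refine tendsto_nhdsWithin_iff.2 ⟨?_, ?_⟩
        · refine Tendsto.mono_left ?_ nhdsWithin_le_nhds
          exact (Continuous.tendsto' (by fun_prop) _ _ (by simp))
        · filter_upwards [self_mem_nhdsWithin] with s hs
          exact mul_ne_zero (Complex.ofReal_ne_zero.2 hs) hη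
      have h2 := (tendsto_slope_expMul.comp h1).const_mul (coord ^ j * expMul (c + t * η))
      have h3 : ∀ᶠ s : ℝ in 𝓝[≠] 0, t + s ∈ Set.Ioo a b := by
        refine nhdsWithin_le_nhds ?_
        have : Tendsto (fun s : ℝ => t + s) (𝓝 0) (𝓝 t) :=
          Continuous.tendsto' (by fun_prop) _ _ (by simp)
        exact this (Ioo_mem_nhds ht.1 ht.2)
      have h4 := hM.mem_of_tendsto h2 (h3.mono fun s hs => ?_)
      · rwa [mul_right_comm, ← pow_succ] at h4
      · have e : (coord ^ j * expMul (c + t * η)) * (((s : ℂ) * η)⁻¹ • (expMul (s * η) - 1)) =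
            ((s : ℂ) * η)⁻¹ • (coord ^ j * expMul (c + (t + s : ℝ) * η) -
              coord ^ j * expMul (c + t * η)) := by
          rw [mul_smul_comm, Complex.ofReal_add, add_mul, ← add_assoc, expMul_add (c + t * η)]
          ring_nf
        exact e ▸ M.smul_mem _ (M.sub_mem (ih _ hs) (ih _ ht))
  rw [← dense_closure]
  have : M = ⊤ := by
    -- Multiplication by an exponential is invertible, so `f * exp (-c * z)` may replace `f`.
    refine Submodule.eq_top_iff'.2 fun f => ?_
    obtain ⟨t, ht⟩ := Set.nonempty_Ioo.2 hab
    have := mul_mem_of_forall_coord_pow_mul_mem hM (fun j => key j t ht)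
      (f * expMul (-(c + t * η)))
    rwa [mul_assoc, ← expMul_add, neg_add_cancel, expMul_zero, mul_one] at this
  have h2 : closure (S : Set EntireFunction) = Set.univ := by
    rw [← Submodule.topologicalClosure_coe]
    exact congrArg _ this
  rw [h2]
  exact dense_univ

end EntireFunction

end

/-! ### A Baire category criterion for hypercyclic algebras -/

theorem ContinuousLinearMap.aeval_apply_of_apply_eq_smul {E : Type*} [TopologicalSpace E]
    [AddCommGroup E] [Module ℂ E] [IsTopologicalAddGroup E] [ContinuousConstSMul ℂ E]
    {T : E →L[ℂ] E} {x : E} {c : ℂ} (h : T x = c • x) (p : ℂ[X]) :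
    aeval T p x = p.eval c • x := by
  have hpow : ∀ i : ℕ, (T ^ i) x = c ^ i • x := fun i => by
    induction i with
    | zero => simp
    | succ i ih =>
      rw [pow_succ, pow_succ', mul_smul, ← ih, ← map_smul, ← h]
      rfl
  induction p using Polynomial.induction_on' with
  | add p q hp hq => rw [map_add, add_apply, hp, hq, eval_add, add_smul]
  | monomial i a =>
    rw [aeval_monomial, ← Algebra.smul_def, smul_apply, hpow, smul_smul, eval_monomial]

theorem exists_nhds_zero_forall_sum_smul_mem {E : Type*} [TopologicalSpace E]
    [AddCommGroup E] [Module ℂ E] [ContinuousAdd E] [ContinuousConstSMul ℂ E]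
    (c : ℕ → ℂ) (m : ℕ) {O : Set E} (hO : O ∈ 𝓝 0) :
    ∃ W ∈ 𝓝 (0 : E), ∀ y : ℕ → E, (∀ i < m, y i ∈ W) → ∑ i ∈ Finset.range m, c i • y i ∈ O := by
  induction m generalizing O with
  | zero => exact ⟨Set.univ, univ_mem, fun y _ => by simpa using mem_of_mem_nhds hO⟩
  | succ m ih =>
    obtain ⟨O', hO', hadd⟩ := exists_nhds_zero_half hO
    obtain ⟨W, hW, h⟩ := ih hO'
    have hc : Tendsto (fun x : E => c m • x) (𝓝 0) (𝓝 0) :=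
      Continuous.tendsto' (by fun_prop) _ _ (smul_zero _)
    refine ⟨W ∩ (fun x => c m • x) ⁻¹' O', inter_mem hW (hc hO'), fun y hy => ?_⟩
    rw [Finset.sum_range_succ]
    exact hadd _ (h y fun i hi => (hy i (hi.trans m.lt_succ_self)).1) _ (hy m m.lt_succ_self).2

theorem exists_aeval_eq_of_mem_adjoin_singleton {X : Type*} [CommRing X] [Algebra ℂ X] {f g : X}
    (hg : g ∈ NonUnitalAlgebra.adjoin ℂ {f}) : ∃ p : ℂ[X], p.coeff 0 = 0 ∧ aeval f p = g := by
  induction hg using NonUnitalAlgebra.adjoin_induction with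
  | mem x hx => exact ⟨Polynomial.X, by simp, by simpa using hx.symm⟩
  | add x y _ _ hx hy =>
    obtain ⟨p, hp, rfl⟩ := hx
    obtain ⟨q, hq, rfl⟩ := hy
    exact ⟨p + q, by simp [hp, hq], by simp⟩
  | zero => exact ⟨0, by simp, by simp⟩
  | mul x y _ _ hx hy =>
    obtain ⟨p, hp, rfl⟩ := hx
    obtain ⟨q, hq, rfl⟩ := hy
    exact ⟨p * q, by simp [mul_coeff_zero, hp], by simp⟩
  | smul r x _ hx =>
    obtain ⟨p, hp, rfl⟩ := hx
    exact ⟨r • p, by simp [hp], by simp⟩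

/-- A Birkhoff-type criterion: if powers of vectors can be steered so that the top power `f ^ m`
reaches any given open set while the lower powers become small, then a generic vector generates a
hypercyclic algebra. -/
theorem supportsHypercyclicAlgebra_of_forall_exists {X : Type*} [TopologicalSpace X] [CommRing X]
    [Algebra ℂ X] [IsTopologicalRing X] [ContinuousSMul ℂ X] [BaireSpace X]
    [SecondCountableTopology X] [T1Space X] [Nontrivial X] (T : X →L[ℂ] X)
    (H : ∀ m : ℕ, 1 ≤ m → ∀ U V W : Set X, IsOpen U → IsOpen V → IsOpen W → U.Nonempty →
      V.Nonempty → 0 ∈ W → ∃ f ∈ U, ∃ q : ℕ, (T ^ q) (f ^ m) ∈ V ∧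
        ∀ j, 0 < j → j < m → (T ^ q) (f ^ j) ∈ W) :
    SupportsHypercyclicAlgebra T := by
  classical
  set B := TopologicalSpace.countableBasis X
  have hB := TopologicalSpace.isBasis_countableBasis X
  set G : ℕ → Set X → Set X → Set X := fun m V W =>
    {f | ∃ q : ℕ, (T ^ q) (f ^ m) ∈ V ∧ ∀ j ∈ Finset.Ioo 0 m, (T ^ q) (f ^ j) ∈ W}
  have hopen : ∀ m, ∀ V ∈ B, ∀ W ∈ B, IsOpen (G m V W) := by
    intro m V hV W hW
    have : G m V W = ⋃ q : ℕ, ((fun f : X => (T ^ q) (f ^ m)) ⁻¹' V ∩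
        ⋂ j ∈ Finset.Ioo 0 m, (fun f : X => (T ^ q) (f ^ j)) ⁻¹' W) := by
      ext f; simp [G]
    rw [this]
    refine isOpen_iUnion fun q => ((hB.isOpen hV).preimage (by fun_prop)).inter ?_
    exact isOpen_biInter_finset fun j _ => (hB.isOpen hW).preimage (by fun_prop)
  have hdense : Dense (⋂ i : {i : ℕ × B × B // 1 ≤ i.1 ∧ (i.2.1 : Set X).Nonempty ∧
      (0 : X) ∈ (i.2.2 : Set X)}, G i.1.1 i.1.2.1 i.1.2.2) := by
    have : Countable B := (TopologicalSpace.countable_countableBasis X).to_subtype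
    refine dense_iInter_of_isOpen (fun i => hopen _ _ i.1.2.1.2 _ i.1.2.2.2) fun i => ?_
    refine dense_iff_inter_open.2 fun U hU hUn => ?_
    obtain ⟨f, hf, q, h1, h2⟩ := H _ i.2.1 U _ _ hU (hB.isOpen i.1.2.1.2) (hB.isOpen i.1.2.2.2) hUn
      i.2.2.1 i.2.2.2
    exact ⟨f, hf, q, h1, fun j hj => h2 j (Finset.mem_Ioo.1 hj).1 (Finset.mem_Ioo.1 hj).2⟩
  obtain ⟨f, hf⟩ := hdense.nonempty
  have key : ∀ m : ℕ, 1 ≤ m → ∀ v : X, ∀ V ∈ 𝓝 v, ∀ W ∈ 𝓝 (0 : X), ∃ q : ℕ, (T ^ q) (f ^ m) ∈ V ∧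
      ∀ j, 0 < j → j < m → (T ^ q) (f ^ j) ∈ W := by
    intro m hm v V hV W hW
    obtain ⟨V', hV', hv, hVV⟩ := hB.mem_nhds_iff.1 hV
    obtain ⟨W', hW', hw, hWW⟩ := hB.mem_nhds_iff.1 hW
    obtain ⟨q, h1, h2⟩ := Set.mem_iInter.1 hf ⟨(m, ⟨V', hV'⟩, ⟨W', hW'⟩), hm, ⟨v, hv⟩, hw⟩
    exact ⟨q, hVV h1, fun j h0 hj => hWW (h2 j (Finset.mem_Ioo.2 ⟨h0, hj⟩))⟩
  refine ⟨NonUnitalAlgebra.adjoin ℂ {f}, fun hbot => ?_, fun g hg hg0 => ?_⟩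
  · have hf0 : f = 0 := by
      have := NonUnitalAlgebra.self_mem_adjoin_singleton ℂ f
      rwa [hbot, NonUnitalAlgebra.mem_bot] at this
    obtain ⟨v, hv⟩ := exists_ne (0 : X)
    obtain ⟨q, h, -⟩ := key 1 le_rfl v {0}ᶜ (isOpen_compl_singleton.mem_nhds hv) _ univ_mem
    simp [hf0] at h
  · obtain ⟨p, hp0, rfl⟩ := exists_aeval_eq_of_mem_adjoin_singleton hg
    have hp : p ≠ 0 := by rintro rfl; simp at hg0
    set m := p.natDegree
    have hm : 1 ≤ m := by
      by_contra! h
      have hm0 : p.natDegree = 0 := by omega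
      refine hp (leadingCoeff_eq_zero.1 ?_)
      rw [leadingCoeff, hm0, hp0]
    have hc : p.coeff m ≠ 0 := leadingCoeff_ne_zero.2 hp
    refine dense_iff_inter_open.2 fun O hO ⟨v, hv⟩ => ?_
    have hadd : Tendsto (fun x : X × X => p.coeff m • x.1 + x.2)
        (𝓝 ((p.coeff m)⁻¹ • v) ×ˢ 𝓝 0) (𝓝 v) := by
      rw [← nhds_prod_eq]
      exact Continuous.tendsto' (by fun_prop) _ _ (by simp [smul_smul, hc])
    obtain ⟨V, hV, W₀, hW₀, hVW⟩ := mem_prod_iff.1 (hadd (hO.mem_nhds hv))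
    obtain ⟨W, hW, hsum⟩ := exists_nhds_zero_forall_sum_smul_mem p.coeff m hW₀
    obtain ⟨q, h1, h2⟩ := key m hm _ V hV W hW
    refine ⟨_, ?_, q, rfl⟩
    have hW0 := hsum (fun i => if i = 0 then 0 else (T ^ q) (f ^ i)) fun i hi => by
      split_ifs with h
      · exact mem_of_mem_nhds hW
      · exact h2 i (Nat.pos_of_ne_zero h) hi
    have hmem := hVW (Set.mk_mem_prod h1 hW0)
    have e : (T ^ q) (aeval f p) = p.coeff m • (T ^ q) (f ^ m) +
        ∑ i ∈ Finset.range m, p.coeff i • (if i = 0 then 0 else (T ^ q) (f ^ i)) := by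
      rw [aeval_eq_sum_range, map_sum, Finset.sum_range_succ, add_comm, map_smul]
      congr 1
      refine Finset.sum_congr rfl fun i _ => ?_
      rw [map_smul]
      split_ifs with h
      · rw [h, hp0, zero_smul, zero_smul]
      · rfl
    exact (congrArg (· ∈ O) e).mpr hmem

/-! ### Estimates for `(1 + b) * w ^ k - b` -/

/-- The disk with diameter `[0, 1]` is mapped into the unit disk by `v ↦ (1 + b) * v - b`. -/
theorem norm_mul_sub_lt_one {b : ℝ} (hb0 : 0 ≤ b) (hb1 : b ≤ 1) {v : ℂ}
    (hv : Complex.normSq v < v.re) : ‖(1 + b : ℂ) * v - b‖ < 1 := by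
  have h1 : v.re < 1 := by
    rw [Complex.normSq_apply] at hv
    nlinarith [mul_self_nonneg v.im, mul_self_nonneg v.re]
  have h0 := Complex.normSq_nonneg v
  have h2 : Complex.normSq ((1 + b : ℂ) * v - b) < 1 := by
    have e : Complex.normSq ((1 + b : ℂ) * v - b) =
        (1 + b) * ((1 - b) * Complex.normSq v + 2 * b * (Complex.normSq v - v.re)) + b ^ 2 := by
      simp [Complex.normSq_apply]
      ring
    rw [e]
    have h3 : Complex.normSq v < 1 := hv.trans h1
    rcases hb0.eq_or_lt with rfl | hb
    · simpa using h3
    · nlinarith [mul_nonneg (sub_nonneg.2 hb1) (sub_nonneg.2 h3.le), mul_pos hb (sub_pos.2 hv)]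
  rw [Complex.normSq_eq_norm_sq] at h2
  exact (sq_lt_one_iff₀ (norm_nonneg _)).1 h2

/-- On a truncated thin sector around the segment `(0, ρ]`, with `ρ < 1`, the polynomial
`(1 + b) * w ^ k - b` has modulus less than `1`. -/
theorem exists_sector_norm_lt_one {b ρ : ℝ} (hb0 : 0 ≤ b) (hb1 : b ≤ 1) (hρ0 : 0 ≤ ρ) (hρ1 : ρ < 1)
    {k : ℕ} (hk : k ≠ 0) :
    ∃ η > 0, ∀ x y : ℝ, 0 < x → x ≤ ρ → |y| ≤ η * x →
      ‖(1 + b : ℂ) * (x + y * Complex.I) ^ k - b‖ < 1 := by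
  have hcont : Tendsto (fun t : ℝ => ((1 + t * Complex.I : ℂ) ^ k).re -
      ρ ^ k * Complex.normSq ((1 + t * Complex.I : ℂ) ^ k)) (𝓝 0) (𝓝 (1 - ρ ^ k)) := by
    refine Continuous.tendsto' ?_ _ _ (by simp)
    have := Complex.continuous_normSq
    fun_prop
  obtain ⟨η, hη, h⟩ := Metric.eventually_nhds_iff.1
    (hcont.eventually_const_lt (sub_pos.2 (pow_lt_one₀ hρ0 hρ1 hk)))
  refine ⟨η / 2, half_pos hη, fun x y hx hxρ hy => norm_mul_sub_lt_one hb0 hb1 ?_⟩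
  have ht := @h (y / x) (by
    rw [Real.dist_eq, sub_zero, abs_div, abs_of_pos hx, div_lt_iff₀ hx]
    nlinarith [mul_pos hη hx])
  have e : ((x : ℂ) + y * Complex.I) = x * (1 + (y / x : ℝ) * Complex.I) := by
    have : (x : ℂ) ≠ 0 := Complex.ofReal_ne_zero.2 hx.ne'
    push_cast
    field_simp
  set u := (1 + (y / x : ℝ) * Complex.I : ℂ) ^ k
  have hxk : 0 < x ^ k := pow_pos hx k
  rw [e, mul_pow, ← Complex.ofReal_pow, Complex.re_ofReal_mul, map_mul, Complex.normSq_ofReal,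
    mul_assoc]
  refine mul_lt_mul_of_pos_left (lt_of_le_of_lt ?_ (sub_pos.1 ht)) hxk
  exact mul_le_mul_of_nonneg_right (pow_le_pow_left₀ hx.le hxρ k) (Complex.normSq_nonneg _)

/-- Along the tangent `t ↦ 1 + t * I` the function `log ‖c * w ^ k - b‖` is strictly convex near
`t = 0`. It is harmonic in `w` and strictly concave in the radial direction. -/
theorem exists_strictConvexOn_log_norm {b c : ℝ} (hb : 0 ≤ b) (hbc : b < c) {k : ℕ} (hk : 1 ≤ k) :
    ∃ ε > 0, StrictConvexOn ℝ (Set.Ioo (-ε) ε)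
      fun t : ℝ => Real.log ‖(c : ℂ) * (1 + t * Complex.I) ^ k - b‖ := by
  -- Near `0` the function is the real part of `log L`, holomorphic in a complex variable `t`.
  set L : ℂ → ℂ := fun w => (c : ℂ) * (1 + w * Complex.I) ^ k - b with hL
  set L' : ℂ → ℂ := fun w => (c : ℂ) * (k * (1 + w * Complex.I) ^ (k - 1) * Complex.I) with hL'
  set L'' : ℂ → ℂ := fun w => (c : ℂ) * (k * ((k - 1 : ℕ) * (1 + w * Complex.I) ^ (k - 1 - 1) *
    Complex.I) * Complex.I) with hL''
  have hlin : ∀ w, HasDerivAt (fun w : ℂ => 1 + w * Complex.I) Complex.I w := fun w => by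
    simpa using ((hasDerivAt_id w).mul_const Complex.I).const_add 1
  have d1 : ∀ w, HasDerivAt L (L' w) w := fun w =>
    (((hlin w).pow k).const_mul (c : ℂ)).sub_const (b : ℂ)
  have d2 : ∀ w, HasDerivAt L' (L'' w) w := fun w =>
    ((((hlin w).pow (k - 1)).const_mul (k : ℂ)).mul_const Complex.I).const_mul (c : ℂ)
  have hL0 : L 0 = ((c - b : ℝ) : ℂ) := by simp [hL]
  have hpos0 : 0 < (((L'' 0) * L 0 - L' 0 * L' 0) / L 0 ^ 2).re := by
    -- Here the terms with `I ^ 2 = -1` give `c k (c k - (k - 1) (c - b)) = c k (c + (k - 1) b) > 0`.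
    have e : ((L'' 0) * L 0 - L' 0 * L' 0) / L 0 ^ 2 =
        ((c * k * (c + (k - 1 : ℕ) * b) / (c - b) ^ 2 : ℝ) : ℂ) := by
      have hkk : (k : ℂ) = (k - 1 : ℕ) + 1 := by exact_mod_cast (Nat.sub_add_cancel hk).symm
      rw [hL0]
      push_cast
      congr 1
      simp only [hL', hL'', zero_mul, add_zero, one_pow, mul_one]
      have hI := Complex.I_mul_I
      linear_combination (c * k * (k - 1 : ℕ) * (c - b) - c * k * (c * k)) * hI + c * k * c * hkk
    rw [e, Complex.ofReal_re]
    have : (0 : ℝ) < k := by exact_mod_cast hk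
    have hc : 0 < c := hb.trans_lt hbc
    have := sub_pos.2 hbc
    positivity
  have hslit0 : L 0 ∈ Complex.slitPlane := by
    rw [hL0, Complex.ofReal_mem_slitPlane]
    exact sub_pos.2 hbc
  have hcL : Continuous L := by fun_prop
  have hcL' : Continuous L' := by fun_prop
  have hcL'' : Continuous L'' := by fun_prop
  have hev : ∀ᶠ t : ℝ in 𝓝 0, L t ∈ Complex.slitPlane ∧
      0 < (((L'' t) * L t - L' t * L' t) / L t ^ 2).re := by
    have hof : Tendsto (fun t : ℝ => (t : ℂ)) (𝓝 0) (𝓝 0) :=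
      Continuous.tendsto' Complex.continuous_ofReal _ _ Complex.ofReal_zero
    refine (hof.eventually ((hcL.tendsto 0).eventually
      (Complex.isOpen_slitPlane.mem_nhds hslit0))).and ?_
    have hca : ContinuousAt (fun w => (((L'' w) * L w - L' w * L' w) / L w ^ 2).re) 0 := by
      refine Complex.continuous_re.continuousAt.comp (ContinuousAt.div ?_ ?_ ?_)
      · fun_prop
      · fun_prop
      · exact pow_ne_zero 2 (Complex.slitPlane_ne_zero hslit0)
    exact hof.eventually (hca.eventually_const_lt hpos0)
  obtain ⟨ε, hε, h⟩ := Metric.eventually_nhds_iff.1 hev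
  have hmem : ∀ t ∈ Set.Ioo (-ε) ε, L t ∈ Complex.slitPlane ∧
      0 < (((L'' t) * L t - L' t * L' t) / L t ^ 2).re := fun t ht =>
    h (by rw [Real.dist_eq, sub_zero]; exact abs_lt.2 ht)
  have D1 : ∀ t ∈ Set.Ioo (-ε) ε, HasDerivAt (fun t : ℝ => Real.log ‖L t‖) (L' t / L t).re t := by
    intro t ht
    have := ((d1 t).clog (hmem t ht).1).real_of_complex
    simpa only [Complex.log_re] using this
  have D2 : ∀ t ∈ Set.Ioo (-ε) ε, HasDerivAt (fun t : ℝ => (L' t / L t).re)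
      (((L'' t) * L t - L' t * L' t) / L t ^ 2).re t := fun t ht =>
    ((d2 t).div (d1 t) (Complex.slitPlane_ne_zero (hmem t ht).1)).real_of_complex
  refine ⟨ε, hε, strictConvexOn_of_deriv2_pos (convex_Ioo _ _)
    (fun t ht => (D1 t ht).continuousAt.continuousWithinAt) fun t ht => ?_⟩
  rw [interior_Ioo] at ht
  have he : deriv (fun t : ℝ => Real.log ‖L t‖) =ᶠ[𝓝 t] fun t : ℝ => (L' t / L t).re :=
    Filter.eventually_of_mem (Ioo_mem_nhds ht.1 ht.2) fun t ht => (D1 t ht).deriv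
  exact lt_of_lt_of_eq (hmem t ht).2 (((D2 t ht).congr_of_eventuallyEq he).deriv).symm

/-! ### Operators with multiplicative eigenvectors -/

theorem ContinuousLinearMap.pow_apply_of_apply_eq_smul {E : Type*} [TopologicalSpace E]
    [AddCommGroup E] [Module ℂ E] [IsTopologicalAddGroup E] [ContinuousConstSMul ℂ E]
    {T : E →L[ℂ] E} {x : E} {c : ℂ} (h : T x = c • x) (q : ℕ) : (T ^ q) x = c ^ q • x := by
  simpa using aeval_apply_of_apply_eq_smul h (Polynomial.X ^ q)

theorem map_sum_eq_prod_of_map_add {X : Type*} [CommRing X] {e : ℂ → X} (h0 : e 0 = 1)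
    (hadd : ∀ v w, e (v + w) = e v * e w)
    {κ : Type*} (s : Finset κ) (w : κ → ℂ) : e (∑ i ∈ s, w i) = ∏ i ∈ s, e (w i) := by
  classical
  induction s using Finset.induction_on with
  | empty => simp [h0]
  | insert i s hi ih => rw [Finset.sum_insert hi, Finset.prod_insert hi, hadd, ih]

section EigenvectorCharacter

variable {X : Type*} [TopologicalSpace X] [CommRing X] [Algebra ℂ X] [IsTopologicalRing X]
  {T : X →L[ℂ] X} {e : ℂ → X} {Q : ℂ → ℂ}

/-- Iterates of an operator with multiplicative eigenvectors, applied to powers of combinations of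
eigenvectors. -/
theorem pow_apply_sum_smul_pow (h0 : e 0 = 1) (hadd : ∀ v w, e (v + w) = e v * e w)
    (heig : ∀ w, T (e w) = Q w • e w) {ι : Type*} [Fintype ι] (d r β : ι → ℂ) (l N : ℕ) :
    (T ^ N) ((∑ i, (d i * r i ^ N) • e (β i)) ^ l) =
      ∑ σ : Fin l → ι, ((∏ i, d (σ i)) * ((∏ i, r (σ i)) * Q (∑ i, β (σ i))) ^ N) •
        e (∑ i, β (σ i)) := by
  classical
  rw [Fintype.sum_pow, map_sum]
  refine Finset.sum_congr rfl fun σ _ => ?_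
  rw [Finset.prod_smul, ← map_sum_eq_prod_of_map_add h0 hadd, map_smul,
    ContinuousLinearMap.pow_apply_of_apply_eq_smul (heig _), smul_smul, Finset.prod_mul_distrib,
    Finset.prod_pow, mul_pow, mul_assoc]

theorem tendsto_pow_apply_sum_smul_pow_zero [ContinuousSMul ℂ X] (h0 : e 0 = 1)
    (hadd : ∀ v w, e (v + w) = e v * e w) (heig : ∀ w, T (e w) = Q w • e w)
    {ι : Type*} [Fintype ι] (d r β : ι → ℂ) (l : ℕ)
    (h : ∀ σ : Fin l → ι, ‖(∏ i, r (σ i)) * Q (∑ i, β (σ i))‖ < 1) :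
    Tendsto (fun N => (T ^ N) ((∑ i, (d i * r i ^ N) • e (β i)) ^ l)) atTop (𝓝 0) := by
  simp only [pow_apply_sum_smul_pow h0 hadd heig]
  refine (tendsto_finsetSum _ fun σ _ => ((tendsto_pow_atTop_nhds_zero_of_norm_lt_one
    (h σ)).const_mul (∏ i, d (σ i))).smul_const (e (∑ i, β (σ i)))).trans_eq ?_
  simp

/-- If the only ratios of modulus at least `1` come from `m` copies of one index in `κ`, and these
ratios equal `1`, then only these terms survive in the limit. -/
theorem tendsto_pow_apply_sum_smul_pow [ContinuousSMul ℂ X] (h0 : e 0 = 1)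
    (hadd : ∀ v w, e (v + w) = e v * e w) (heig : ∀ w, T (e w) = Q w • e w)
    {ι κ : Type*} [Fintype ι] [Fintype κ] (d r β : ι ⊕ κ → ℂ)
    {m : ℕ} (hm : m ≠ 0)
    (h : ∀ σ : Fin m → ι ⊕ κ, (∀ q, σ ≠ fun _ => Sum.inr q) →
      ‖(∏ i, r (σ i)) * Q (∑ i, β (σ i))‖ < 1)
    (h1 : ∀ q, r (Sum.inr q) ^ m * Q (m * β (Sum.inr q)) = 1) :
    Tendsto (fun N => (T ^ N) ((∑ i, (d i * r i ^ N) • e (β i)) ^ m)) atTop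
      (𝓝 (∑ q, d (Sum.inr q) ^ m • e (m * β (Sum.inr q)))) := by
  classical
  have : Nonempty (Fin m) := ⟨⟨0, Nat.pos_of_ne_zero hm⟩⟩
  simp only [pow_apply_sum_smul_pow h0 hadd heig]
  set φ : κ → Fin m → ι ⊕ κ := fun q _ => Sum.inr q
  have hφ : Function.Injective φ := fun q q' hq =>
    Sum.inr_injective (congrFun hq (Classical.arbitrary _))
  have hlim : ∀ σ : Fin m → ι ⊕ κ, Tendsto (fun N : ℕ => ((∏ i, r (σ i)) * Q (∑ i, β (σ i))) ^ N)
      atTop (𝓝 (if σ ∈ Finset.univ.image φ then 1 else 0)) := by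
    intro σ
    split_ifs with hσ
    · obtain ⟨q, -, rfl⟩ := Finset.mem_image.1 hσ
      simp [φ, h1]
    · refine tendsto_pow_atTop_nhds_zero_of_norm_lt_one (h σ fun q hq => hσ ?_)
      exact Finset.mem_image.2 ⟨q, Finset.mem_univ _, hq.symm⟩
  refine (tendsto_finsetSum _ fun σ _ => ((hlim σ).const_mul (∏ i, d (σ i))).smul_const
    (e (∑ i, β (σ i)))).trans_eq ?_
  simp only [mul_ite, mul_one, mul_zero, ite_smul, zero_smul]
  rw [← Finset.sum_filter, Finset.filter_mem_eq_inter, Finset.univ_inter,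
    Finset.sum_image hφ.injOn]
  simp [φ]

end EigenvectorCharacter

/-- Strict Jensen inequality for `log ‖Q‖` on a segment, in multiplicative form: averages of `m`
points that are not all equal have smaller `‖Q‖` than the geometric mean of the values. -/
theorem prod_mul_norm_lt_one_of_strictConvexOn {Q : ℂ → ℂ} {s ε : ℝ}
    (hconv : StrictConvexOn ℝ (Set.Ioo (-ε) ε)
      fun t : ℝ => Real.log ‖Q (s * (1 + t * Complex.I))‖)
    (hQ : ∀ t ∈ Set.Ioo (-ε) ε, 1 < ‖Q (s * (1 + (t : ℝ) * Complex.I))‖) {m : ℕ}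
    {t : Fin m → ℝ} (ht : ∀ i, t i ∈ Set.Ioo (-ε) ε) {i j : Fin m} (hij : t i ≠ t j) {r : Fin m → ℂ}
    (hr : ∀ i, r i ^ m * Q (s * (1 + t i * Complex.I)) = 1) :
    ‖(∏ i, r i) * Q (∑ i, s * (1 + t i * Complex.I) / m)‖ < 1 := by
  have hm : 0 < m := i.pos
  have hmR : (0 : ℝ) < m := Nat.cast_pos.2 hm
  have hmC : (m : ℂ) ≠ 0 := Nat.cast_ne_zero.2 hm.ne'
  have hw : ∑ _i : Fin m, (m : ℝ)⁻¹ = 1 := by simp [hmR.ne']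
  have hJ := hconv.map_sum_lt (t := Finset.univ) (w := fun _ => (m : ℝ)⁻¹) (p := t)
    (fun _ _ => inv_pos.2 hmR) hw (fun i _ => ht i) ⟨i, Finset.mem_univ _, j, Finset.mem_univ _, hij⟩
  have hav := hconv.1.sum_mem (t := Finset.univ) (w := fun _ => (m : ℝ)⁻¹) (z := t)
    (fun _ _ => (inv_pos.2 hmR).le) hw (fun i _ => ht i)
  set a : ℝ := ∑ i, (m : ℝ)⁻¹ • t i with ha
  have hsum : ∑ i, (s : ℂ) * (1 + t i * Complex.I) / m = s * (1 + a * Complex.I) := by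
    rw [ha, ← Finset.sum_div, ← Finset.mul_sum, Finset.sum_add_distrib, ← Finset.sum_mul]
    simp only [Finset.sum_const, Finset.card_univ, Fintype.card_fin, nsmul_eq_mul, mul_one,
      smul_eq_mul, ← Finset.mul_sum, Complex.ofReal_mul, Complex.ofReal_inv, Complex.ofReal_natCast,
      Complex.ofReal_sum]
    field_simp
  have hr0 : ∀ i, r i ≠ 0 := fun i h0 => by
    have := hr i
    rw [h0, zero_pow hm.ne', zero_mul] at this
    exact zero_ne_one this
  have hlog : ∀ i, Real.log ‖Q (s * (1 + t i * Complex.I))‖ = -(m * Real.log ‖r i‖) := fun i => by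
    have h := congrArg (fun z => Real.log ‖z‖) (hr i)
    simp only [norm_mul, norm_pow, norm_one, Real.log_one] at h
    rw [Real.log_mul (pow_ne_zero _ (norm_ne_zero_iff.2 (hr0 i)))
      (one_pos.trans (hQ _ (ht i))).ne',
      Real.log_pow] at h
    linarith
  have hpos : 0 < ‖Q (s * (1 + a * Complex.I))‖ := one_pos.trans (hQ a hav)
  rw [hsum, norm_mul, norm_prod]
  have hprod : 0 < ∏ i, ‖r i‖ := Finset.prod_pos fun i _ => norm_pos_iff.2 (hr0 i)
  rw [← Real.log_neg_iff (mul_pos hprod hpos), Real.log_mul hprod.ne' hpos.ne',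
    Real.log_prod fun i _ => norm_ne_zero_iff.2 (hr0 i)]
  have : ∑ i, (m : ℝ)⁻¹ • Real.log ‖Q (s * (1 + t i * Complex.I))‖ = -∑ i, Real.log ‖r i‖ := by
    rw [← Finset.sum_neg_distrib]
    refine Finset.sum_congr rfl fun i _ => ?_
    rw [hlog, smul_eq_mul]
    field_simp
  linarith

/-- An operator whose eigenvectors `e w` form a character `w ↦ e w` supports a hypercyclic algebra
if its eigenvalues have modulus less than `1` on thin sectors around `(0, ρ]` for `ρ < 1`, and have
modulus greater than `1`, with strictly convex logarithm, on short segments through each `s > 1`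
orthogonal to the real axis. -/
theorem supportsHypercyclicAlgebra_of_character {X : Type*} [TopologicalSpace X] [CommRing X]
    [Algebra ℂ X] [IsTopologicalRing X] [ContinuousSMul ℂ X] [BaireSpace X]
    [SecondCountableTopology X] [T1Space X] [Nontrivial X] {T : X →L[ℂ] X} {e : ℂ → X} {Q : ℂ → ℂ}
    (h0 : e 0 = 1) (hadd : ∀ v w, e (v + w) = e v * e w) (heig : ∀ w, T (e w) = Q w • e w)
    (hdense : ∀ c η : ℂ, η ≠ 0 → ∀ a b : ℝ, a < b →
      Dense (Submodule.span ℂ (Set.range fun t : Set.Ioo a b => e (c + (t : ℝ) * η)) : Set X))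
    (hsector : ∀ ρ : ℝ, 0 ≤ ρ → ρ < 1 → ∃ η > 0, ∀ x y : ℝ, 0 < x → x ≤ ρ → |y| ≤ η * x →
      ‖Q (x + y * Complex.I)‖ < 1)
    (htangent : ∀ s : ℝ, 1 < s → ∃ ε > 0, StrictConvexOn ℝ (Set.Ioo (-ε) ε)
        (fun t : ℝ => Real.log ‖Q (s * (1 + t * Complex.I))‖) ∧
      ∀ t ∈ Set.Ioo (-ε) ε, 1 < ‖Q (s * (1 + (t : ℝ) * Complex.I))‖) :
    SupportsHypercyclicAlgebra T := by
  refine supportsHypercyclicAlgebra_of_forall_exists T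
    fun m hm U V W hU hV hW hUn hVn hW0 => ?_
  have hmR : (1 : ℝ) ≤ m := by exact_mod_cast hm
  have hm0 : (0 : ℝ) < m := by linarith
  have hmC : (m : ℂ) ≠ 0 := Nat.cast_ne_zero.2 (by omega)
  -- The real part of a sum of at most `m` exponents, not all of them `s * (1 + t * I) / m`, is at
  -- most `(m - 1) * s / m + δ`; the choice of `s` and `δ` makes this less than `1`.
  set s : ℝ := 1 + 1 / (2 * m) with hs
  set δ : ℝ := 1 / (4 * m) with hδ
  have hs1 : 1 < s := lt_add_of_pos_right _ (by positivity)
  have hδ0 : 0 < δ := by positivity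
  have hδs : δ ≤ s / m := by
    rw [hδ, div_le_div_iff₀ (by positivity) hm0]
    nlinarith
  set ρ : ℝ := (m - 1) * (s / m) + δ with hρ
  have hρ0 : 0 ≤ ρ := by
    have : 0 ≤ ((m : ℝ) - 1) * (s / m) := mul_nonneg (by linarith) (by positivity)
    linarith
  have hρ1 : ρ < 1 := by
    have : ρ = 1 - (m + 2) / (4 * m ^ 2) := by
      rw [hρ, hs, hδ]; field_simp; ring
    rw [this, sub_lt_self_iff]
    positivity
  obtain ⟨η, hη, hsec⟩ := hsector ρ hρ0 hρ1
  obtain ⟨ε₀, hε₀, hconv₀, hQ₀⟩ := htangent s hs1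
  set ε := min ε₀ η
  have hε0 : 0 < ε := lt_min hε₀ hη
  have hsub : Set.Ioo (-ε) ε ⊆ Set.Ioo (-ε₀) ε₀ :=
    Set.Ioo_subset_Ioo (neg_le_neg (min_le_left _ _)) (min_le_left _ _)
  have hconv := hconv₀.subset hsub (convex_Ioo _ _)
  have hQ := fun t ht => hQ₀ t (hsub ht)
  obtain ⟨A, hAU, hA⟩ := (hdense 0 1 one_ne_zero 0 δ hδ0).inter_open_nonempty U hU hUn
  obtain ⟨B, hBV, hB⟩ := (hdense s (s * Complex.I) (mul_ne_zero
    (Complex.ofReal_ne_zero.2 (by linarith)) Complex.I_ne_zero) (-ε) ε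
    (by linarith)).inter_open_nonempty V hV hVn
  obtain ⟨a, rfl⟩ := Finsupp.mem_span_range_iff_exists_finsupp.1 hA
  obtain ⟨b, rfl⟩ := Finsupp.mem_span_range_iff_exists_finsupp.1 hB
  choose root hroot using fun c : ℂ => IsAlgClosed.exists_pow_nat_eq c (n := m) (by omega)
  set γ : ℝ → ℂ := fun t => s * (1 + t * Complex.I) with hγ
  set d : a.support ⊕ b.support → ℂ := Sum.elim (fun p => a p) (fun q => root (b q)) with hd
  set r : a.support ⊕ b.support → ℂ :=
    Sum.elim (fun _ => 1) (fun q => root (Q (γ (q.1 : ℝ)))⁻¹) with hr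
  set x : a.support ⊕ b.support → ℝ := Sum.elim (fun p => (p.1 : ℝ)) (fun _ => s / m) with hx
  set y : a.support ⊕ b.support → ℝ := Sum.elim (fun _ => 0) (fun q => s / m * (q.1 : ℝ)) with hy
  set β : a.support ⊕ b.support → ℂ := fun i => x i + y i * Complex.I with hβ
  have hβr : ∀ q, β (Sum.inr q) = γ (q.1 : ℝ) / m := fun q => by
    simp only [hβ, hx, hy, hγ, Sum.elim_inr]
    push_cast
    field_simp
  have hrQ : ∀ q : b.support, r (Sum.inr q) ^ m * Q (γ (q.1 : ℝ)) = 1 := fun q => by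
    simp only [hr, Sum.elim_inr, hroot]
    exact inv_mul_cancel₀ (norm_pos_iff.1 (one_pos.trans (hQ _ q.1.2)))
  have hr1 : ∀ q, ‖r (Sum.inr q)‖ < 1 := fun q => by
    have h1 := congrArg norm (hrQ q)
    have h2 := hQ _ q.1.2
    rw [norm_mul, norm_pow, norm_one] at h1
    by_contra! h
    exact (one_lt_mul_of_le_of_lt (one_le_pow₀ h) h2).ne' h1
  have hr1' : ∀ i, ‖r i‖ ≤ 1 := by
    rintro (p | q)
    · simp [hr]
    · exact (hr1 q).le
  have hx0 : ∀ i, 0 < x i := by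
    rintro (p | q)
    · exact p.1.2.1
    · exact div_pos (by linarith) hm0
  have hxs : ∀ i, x i ≤ s / m := by
    rintro (p | q)
    · exact p.1.2.2.le.trans hδs
    · exact le_rfl
  have hxδ : ∀ p, x (Sum.inl p) ≤ δ := fun p => p.1.2.2.le
  have hyη : ∀ i, |y i| ≤ η * x i := by
    rintro (p | q)
    · simpa [hy] using (mul_pos hη (hx0 (Sum.inl p))).le
    · have hq : |(q.1 : ℝ)| ≤ η := (abs_lt.2 q.1.2).le.trans (min_le_right _ _)
      have : 0 < s / m := div_pos (by linarith) hm0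
      simp only [hx, hy, Sum.elim_inr]
      rw [abs_mul, abs_of_pos this, mul_comm]
      exact mul_le_mul_of_nonneg_right hq this.le
  have hsmall : ∀ (l : ℕ) (σ : Fin l → a.support ⊕ b.support), 0 < l → ∑ i, x (σ i) ≤ ρ →
      ‖(∏ i, r (σ i)) * Q (∑ i, β (σ i))‖ < 1 := by
    intro l σ hl hle
    have hsum : ∑ i, β (σ i) = ((∑ i, x (σ i) : ℝ) : ℂ) + ((∑ i, y (σ i) : ℝ) : ℂ) * Complex.I := by
      simp only [hβ, Finset.sum_add_distrib, Finset.sum_mul, Complex.ofReal_sum]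
    have : Nonempty (Fin l) := ⟨⟨0, hl⟩⟩
    rw [hsum, norm_mul, norm_prod]
    refine mul_lt_one_of_nonneg_of_lt_one_right
      (Finset.prod_le_one (fun _ _ => norm_nonneg _) fun i _ => hr1' _) (norm_nonneg _)
      (hsec _ _ (Finset.sum_pos (fun i _ => hx0 _) Finset.univ_nonempty) hle ?_)
    rw [Finset.mul_sum]
    exact (Finset.abs_sum_le_sum_abs _ _).trans (Finset.sum_le_sum fun i _ => hyη _)
  have hlow : ∀ l, 0 < l → l < m → Tendsto
      (fun N => (T ^ N) ((∑ i, (d i * r i ^ N) • e (β i)) ^ l)) atTop (𝓝 0) := by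
    intro l hl hlm
    refine tendsto_pow_apply_sum_smul_pow_zero h0 hadd heig d r β l fun σ => hsmall l σ hl ?_
    have h1 : ∑ i, x (σ i) ≤ l * (s / m) := by
      simpa using Finset.sum_le_sum fun (i : Fin l) (_ : i ∈ Finset.univ) => hxs (σ i)
    have h2 : (l : ℝ) ≤ m - 1 := by
      rw [le_sub_iff_add_le]; exact_mod_cast hlm
    have h3 : 0 < s / m := div_pos (by linarith) hm0
    rw [hρ]
    nlinarith
  have htop := tendsto_pow_apply_sum_smul_pow (m := m) h0 hadd heig d r β (by omega)
    (fun σ hσ => ?_) (fun q => by rw [hβr, mul_div_cancel₀ _ hmC, hrQ])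
  swap
  · by_cases hinl : ∃ i p, σ i = Sum.inl p
    · obtain ⟨i, p, hip⟩ := hinl
      refine hsmall m σ (by omega) ?_
      rw [← Finset.add_sum_erase _ _ (Finset.mem_univ i), hρ, add_comm]
      refine add_le_add ?_ (hip ▸ hxδ p)
      refine (Finset.sum_le_card_nsmul _ _ _ fun j _ => hxs (σ j)).trans_eq ?_
      rw [Finset.card_erase_of_mem (Finset.mem_univ i), Finset.card_univ, Fintype.card_fin,
        nsmul_eq_mul, Nat.cast_sub hm, Nat.cast_one]
    · push Not at hinl
      have : ∀ i, ∃ q, σ i = Sum.inr q := fun i => by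
        cases h : σ i with
        | inl p => exact (hinl i p h).elim
        | inr q => exact ⟨q, rfl⟩
      choose τ hτ using this
      have hne : ∃ i j, ((τ i).1 : ℝ) ≠ (τ j).1 := by
        by_contra! h
        exact hσ (τ ⟨0, by omega⟩) (funext fun i => by
          rw [hτ i, Subtype.ext (Subtype.ext (h i ⟨0, by omega⟩))])
      obtain ⟨i, j, hij⟩ := hne
      have := prod_mul_norm_lt_one_of_strictConvexOn (m := m) (r := fun i => r (Sum.inr (τ i)))
        (t := fun i => ((τ i).1 : ℝ)) hconv hQ (fun i => (τ i).1.2) hij (fun i => hrQ (τ i))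
      simpa only [hτ, hβr] using this
  have hstart : Tendsto (fun N : ℕ => ∑ i, (d i * r i ^ N) • e (β i)) atTop
      (𝓝 (a.sum fun i c => c • e (0 + ((i : ℝ) : ℂ) * 1))) := by
    simp only [Fintype.sum_sum_type]
    have h1 : ∀ N : ℕ, ∑ p, (d (Sum.inl p) * r (Sum.inl p) ^ N) • e (β (Sum.inl p)) =
        a.sum fun i c => c • e (0 + ((i : ℝ) : ℂ) * 1) := fun N => by
      refine Eq.trans ?_ (Finset.sum_coe_sort a.support
        fun i => a i • e (0 + ((i : ℝ) : ℂ) * 1))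
      simp [hd, hr, hβ, hx, hy]
    simp only [h1]
    have h2 := tendsto_finsetSum (Finset.univ : Finset b.support) fun q _ =>
      ((tendsto_pow_atTop_nhds_zero_of_norm_lt_one (hr1 q)).const_mul (d (Sum.inr q))).smul_const
        (e (β (Sum.inr q)))
    simpa using h2.const_add (a.sum fun i c => c • e (0 + ((i : ℝ) : ℂ) * 1))
  have hend : ∑ q, d (Sum.inr q) ^ m • e (m * β (Sum.inr q)) =
      b.sum fun i c => c • e (s + ((i : ℝ) : ℂ) * (s * Complex.I)) := by
    refine Eq.trans ?_ (Finset.sum_coe_sort b.support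
      fun i => b i • e (s + ((i : ℝ) : ℂ) * (s * Complex.I)))
    refine Finset.sum_congr rfl fun q _ => ?_
    rw [hβr, mul_div_cancel₀ _ hmC]
    simp only [hd, Sum.elim_inr, hroot, hγ]
    congr 2
    ring
  rw [hend] at htop
  have hall : ∀ᶠ N in atTop, ∀ l ∈ Finset.Ioo 0 m,
      (T ^ N) ((∑ i, (d i * r i ^ N) • e (β i)) ^ l) ∈ W :=
    (Finset.eventually_all _).2 fun l hl => (hlow l (Finset.mem_Ioo.1 hl).1
      (Finset.mem_Ioo.1 hl).2).eventually (hW.mem_nhds hW0)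
  obtain ⟨N, h1, h2, h3⟩ := ((hstart.eventually (hU.mem_nhds hAU)).and
    ((htop.eventually (hV.mem_nhds hBV)).and hall)).exists
  exact ⟨_, h1, N, h2, fun j hj hjm => h3 j (Finset.mem_Ioo.2 ⟨hj, hjm⟩)⟩

/-! ### The operator `(a₀ I + a₁ D ^ k) ^ n` -/

theorem exists_norm_eq_one_and_eq_neg_mul_norm (a : ℂ) : ∃ u : ℂ, ‖u‖ = 1 ∧ a = -u * ‖a‖ := by
  rcases eq_or_ne a 0 with rfl | ha
  · exact ⟨1, by simp⟩
  · have : (‖a‖ : ℂ) ≠ 0 := Complex.ofReal_ne_zero.2 (norm_ne_zero_iff.2 ha)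
    refine ⟨-(a / ‖a‖), by simp [ha], by field_simp⟩

theorem corollary2p6 (a₀ a₁ : ℂ) (k n : ℕ) (hk : 1 ≤ k) (hn : 1 ≤ n)
    (ha₀ : ‖a₀‖ ≤ 1) (ha₁ : a₁ ≠ 0) :
    SupportsHypercyclicAlgebra (aeval EntireFunction.diffOp ((C a₀ + C a₁ * X ^ k) ^ n : ℂ[X])) := by
  obtain ⟨u, hu, hau⟩ := exists_norm_eq_one_and_eq_neg_mul_norm a₀
  set b := ‖a₀‖
  have hb0 : 0 ≤ b := norm_nonneg _
  have hu0 : u ≠ 0 := norm_ne_zero_iff.1 (hu ▸ one_ne_zero)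
  -- `z₀` is a farthest point from the origin with `|a₀ + a₁ * z₀ ^ k| ≤ 1`.
  obtain ⟨z₀, hz₀⟩ := IsAlgClosed.exists_pow_nat_eq (u * (1 + b : ℝ) / a₁) (n := k) hk
  have hz0 : z₀ ≠ 0 := by
    rintro rfl
    rw [zero_pow (by omega), eq_comm, div_eq_zero_iff] at hz₀
    exact hz₀.elim (mul_ne_zero hu0 (Complex.ofReal_ne_zero.2 (by linarith))) ha₁
  have hev : ∀ w : ℂ, ‖((C a₀ + C a₁ * X ^ k) ^ n : ℂ[X]).eval (z₀ * w)‖ =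
      ‖(1 + b : ℂ) * w ^ k - b‖ ^ n := fun w => by
    have : a₀ + a₁ * (z₀ * w) ^ k = u * ((1 + b : ℂ) * w ^ k - b) := by
      rw [mul_pow, hz₀]
      nth_rewrite 1 [hau]
      push_cast
      field_simp
      ring
    simp [this, hu]
  refine supportsHypercyclicAlgebra_of_character (e := fun w => EntireFunction.expMul (z₀ * w))
    (Q := fun w => ((C a₀ + C a₁ * X ^ k) ^ n : ℂ[X]).eval (z₀ * w)) ?_ ?_ ?_ ?_ ?_ ?_
  · rw [mul_zero, EntireFunction.expMul_zero]
  · intro v w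
    rw [mul_add, EntireFunction.expMul_add]
  · intro w
    exact ContinuousLinearMap.aeval_apply_of_apply_eq_smul (EntireFunction.diffOp_expMul _) _
  · intro c η hη a b hab
    have := EntireFunction.dense_span_expMul (c := z₀ * c) (mul_ne_zero hz0 hη) hab
    simpa only [mul_add, mul_left_comm z₀] using this
  · intro ρ hρ0 hρ1
    obtain ⟨η, hη, h⟩ := exists_sector_norm_lt_one hb0 ha₀ hρ0 hρ1 (k := k) (by omega)
    refine ⟨η, hη, fun x y hx hxρ hy => ?_⟩
    rw [hev]
    exact pow_lt_one₀ (norm_nonneg _) (h x y hx hxρ hy) (by omega)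
  · intro s hs
    have hsk : 1 < s ^ k := one_lt_pow₀ hs (by omega)
    have hc : 1 + b < (1 + b) * s ^ k := lt_mul_of_one_lt_right (by linarith) hsk
    obtain ⟨ε₁, hε₁, hconv⟩ := exists_strictConvexOn_log_norm hb0
      (c := (1 + b) * s ^ k) (by linarith) hk
    have hcont : Tendsto (fun t : ℝ => ‖(((1 + b) * s ^ k : ℝ) : ℂ) * (1 + t * Complex.I) ^ k - b‖)
        (𝓝 0) (𝓝 ((1 + b) * s ^ k - b)) := by
      refine Continuous.tendsto' (by fun_prop) _ _ ?_
      rw [Complex.ofReal_zero, zero_mul, add_zero, one_pow, mul_one, ← Complex.ofReal_sub,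
        Complex.norm_real, Real.norm_eq_abs, abs_of_pos (by linarith)]
    obtain ⟨ε₂, hε₂, hgt⟩ := Metric.eventually_nhds_iff.1
      (hcont.eventually_const_lt (show (1 : ℝ) < _ by linarith))
    have hev' : ∀ t : ℝ, ‖((C a₀ + C a₁ * X ^ k) ^ n : ℂ[X]).eval
        (z₀ * (s * (1 + t * Complex.I)))‖ =
        ‖(((1 + b) * s ^ k : ℝ) : ℂ) * (1 + t * Complex.I) ^ k - b‖ ^ n := fun t => by
      rw [hev, mul_pow, ← mul_assoc]
      push_cast
      rfl
    refine ⟨min ε₁ ε₂, lt_min hε₁ hε₂, ?_, fun t ht => ?_⟩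
    · have hs := hconv.subset (Set.Ioo_subset_Ioo (neg_le_neg (min_le_left ε₁ ε₂))
        (min_le_left ε₁ ε₂)) (convex_Ioo _ _)
      simp only [hev', Real.log_pow]
      have hnR : (0 : ℝ) < n := by exact_mod_cast hn
      refine ⟨hs.1, fun x hx y hy hxy p q hp hq hpq => ?_⟩
      have := mul_lt_mul_of_pos_left (hs.2 hx hy hxy hp hq hpq) hnR
      simp only [smul_eq_mul] at this ⊢
      linarith
    · rw [hev']
      refine one_lt_pow₀ (hgt ?_) (by omega)
      rw [Real.dist_eq, sub_zero]
      exact (abs_lt.2 ht).trans_le (min_le_right _ _)
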